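/- **Theorem (Consistency of the separable SDRME in discrete space).** Let $\mathcal X$ be a discrete (countable) sample space with the counting measure. For $\tau=(c,\theta)\in\mathbb R\times\mathbb R^d$ let $q(x;\tau)=e^{-c}p(x;\theta)$ be the one-parameter extension of an unnormalized model $p(x;\theta)$, and let $\Theta_\tau\subset\mathbb R\times\mathbb R^d$ be the parameter space. Assume: 1. $f:(0,\infty)\to\mathbb R$ is strictly convex and three times differentiable, with $f''(1)=1$. Write $B_f(u,v)=f(u)-f(v)-f'(v)(u-v)$. 2. $h_1,h_2:(0,\infty)\to(0,\infty)$ are twice differentiable and increasing (in the wide sense), $h_1(w)=h_2(w)\iff w=1$, and $h_1'(1)\ne h_2'(1)$. 3. $\Theta_\tau$ is compact. For all $(c,\theta)\in\Theta_\tau$, $p(x;\theta)>0$ for all $x\in\mathcal X$ and $\sum_{x}p(x;\theta)<\infty$. For each $x$, $\tau\mapsto q(x;\tau)$ is $C^2$ on $\Theta_\tau$. 4. The data $x_1,x_2,\dots$ are i.i.d. with density $\eta^*$ with respect to the counting measure. The model is well specified: $\eta^*(x)=q(x;\tau^*)$ for all $x$, where $\tau^*=(c^*,\theta^*)$ is an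 interior point of $\Theta_\tau$ and $e^{c^*}=\sum_x p(x;\theta^*)$. It is identifiable: for $\tau\in\Theta_\tau$, $q(\cdot;\tau)=\eta^*$ if and only if $\tau=\tau^*$. 5. If $\mathcal X$ is infinite (nothing is assumed here if it is finite), the loss $b(w)=B_f\{h_1(w),h_2(w)\}$ is integrable in the tail of $\eta^*$: there are $K\in\mathbb R$ and $m\in\mathbb N$ with $b(w)\le Kw^m$ for all $w\ge1$, and there is $G:\mathcal X\to\mathbb R$ with $\sum_x\eta^*(x)|G(x)|<\infty$ and $b(w)\le G(x)$ whenever $\eta^*(x)\le w\le1$. Let $p_n(x)=n^{-1}\#\{i\le n: x_i=x\}$ be the empirical density, used also as the plug-in density, so that $w(x;\tau)=q(x;\tau)/p_n(x)$. For each $n\ge1$ let $\hat\tau_{\mathrm s}=\hat\tau_{\mathrm s,n}$ be, almost surely, a minimizer over $\tau\in\Theta_\tau$ of the loss $$B_f[h_1\{w(\cdot;\tau)\},h_2\{w(\cdot;\tau)\};p_n]=\sum_{x\in\mathcal X}p_n(x)\,B_f\bigl(h_1\{w(x;\tau)\},h_2\{w(x;\tau)\}\bigr)=\frac1n\sum_{i=1}^nB_f\bigl(h_1\{w(x_i;\tau)\},h_2\{w(x_i;\tau)\}\bigr).$$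 Then $\hat\tau_{\mathrm s}\to\tau^*$ in probability as $n\to\infty$. -/

import Mathlib

open Set Filter Topology MeasureTheory ProbabilityTheory

noncomputable section

namespace SDRME

/-- The space of the extended parameters `τ = (c, θ)` with `c ∈ ℝ` and `θ ∈ ℝ^d`. Convergence in
probability does not depend on the choice of a norm on it. -/
abbrev Param (d : ℕ) : Type := ℝ × EuclideanSpace ℝ (Fin d)

/-- The one-parameter extended model `q(x; τ) = exp (-c) p(x; θ)`, `τ = (c, θ)`. -/
def extModel {X : Type*} {d : ℕ} (p : X → EuclideanSpace ℝ (Fin d) → ℝ)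
    (τ : Param d) (x : X) : ℝ :=
  Real.exp (-τ.1) * p x τ.2

/-- The pointwise Bregman divergence `f(u) - f(v) - f'(v) (u - v)`. -/
def breg (f : ℝ → ℝ) (u v : ℝ) : ℝ :=
  f u - f v - deriv f v * (u - v)

/-- The separable Bregman divergence `B_f(u, v; a)` of two functions `u`, `v` on a discrete sample
space, under the density `a` with respect to the counting measure. -/
def sepBreg {X : Type*} (f : ℝ → ℝ) (u v a : X → ℝ) : ℝ :=
  ∑' x, a x * breg f (u x) (v x)

open Classical in
/-- The density `p_n` with respect to the counting measure of the empirical distribution of the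
first `n` terms of the sample `s`. -/
def empDensity {X : Type*} (s : ℕ → X) (n : ℕ) (x : X) : ℝ :=
  (((Finset.range n).filter (fun i => s i = x)).card : ℝ) / n

/-- The ratio `w(x; τ) = q(x; τ) / η(x)`. -/
def ratio {X : Type*} {d : ℕ} (p : X → EuclideanSpace ℝ (Fin d) → ℝ) (η : X → ℝ)
    (τ : Param d) (x : X) : ℝ :=
  extModel p τ x / η x

/-- The loss `B_f[h₁{w(·; τ)}, h₂{w(·; τ)}; p_n]`, where `w(x; τ) = q(x; τ) / p_n(x)`: the
empirical density is also the plug-in density. The points outside the sample have weight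
`p_n(x) = 0`. -/
def loss {X : Type*} {d : ℕ} (f h₁ h₂ : ℝ → ℝ) (p : X → EuclideanSpace ℝ (Fin d) → ℝ)
    (s : ℕ → X) (n : ℕ) (τ : Param d) : ℝ :=
  sepBreg f (fun x => h₁ (ratio p (empDensity s n) τ x))
    (fun x => h₂ (ratio p (empDensity s n) τ x)) (empDensity s n)

/-- `t` is a value of the separable self density-ratio matching estimator computed from the first
`n` terms of `s`, that is, a minimizer of the loss over the parameter space. -/
def IsSDRME {X : Type*} {d : ℕ} (f h₁ h₂ : ℝ → ℝ) (p : X → EuclideanSpace ℝ (Fin d) → ℝ)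
    (T : Set (Param d)) (s : ℕ → X) (n : ℕ) (t : Param d) : Prop :=
  t ∈ T ∧ IsMinOn (loss f h₁ h₂ p s n) T t

/-- The conditions on `f : (0, ∞) → ℝ`: strictly convex, three times differentiable, and
`f''(1) = 1`. -/
structure IsGenerator (f : ℝ → ℝ) : Prop where
  strictConvex : StrictConvexOn ℝ (Ioi 0) f
  diff₁ : DifferentiableOn ℝ f (Ioi 0)
  diff₂ : DifferentiableOn ℝ (deriv f) (Ioi 0)
  diff₃ : DifferentiableOn ℝ (deriv (deriv f)) (Ioi 0)
  second_deriv_one : deriv (deriv f) 1 = 1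

/-- The conditions on `h₁`, `h₂`: twice differentiable, increasing (in the wide sense, so that
constants are allowed) functions on `(0, ∞)`, with values in the domain `(0, ∞)` of `f`, which
agree exactly at `1` and have different derivatives there. -/
structure IsMatchingPair (h₁ h₂ : ℝ → ℝ) : Prop where
  mapsTo₁ : MapsTo h₁ (Ioi 0) (Ioi 0)
  mapsTo₂ : MapsTo h₂ (Ioi 0) (Ioi 0)
  mono₁ : MonotoneOn h₁ (Ioi 0)
  mono₂ : MonotoneOn h₂ (Ioi 0)
  diff₁ : DifferentiableOn ℝ h₁ (Ioi 0)
  diff₂ : DifferentiableOn ℝ h₂ (Ioi 0)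
  diff_deriv₁ : DifferentiableOn ℝ (deriv h₁) (Ioi 0)
  diff_deriv₂ : DifferentiableOn ℝ (deriv h₂) (Ioi 0)
  eq_iff : ∀ w : ℝ, 0 < w → (h₁ w = h₂ w ↔ w = 1)
  deriv_ne : deriv h₁ 1 ≠ deriv h₂ 1

/-- Integrability of the loss in the tail of the density `η`: with
`b(w) = B_f{h₁(w), h₂(w)}`, the function `b` has at most polynomial growth at `∞`, and
`x ↦ sup {b(w) : η(x) ≤ w ≤ 1}` has an `η`-integrable majorant `G`. -/
def TailIntegrable {X : Type*} (f h₁ h₂ : ℝ → ℝ) (η : X → ℝ) : Prop :=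
  (∃ (K : ℝ) (m : ℕ), ∀ w : ℝ, 1 ≤ w → breg f (h₁ w) (h₂ w) ≤ K * w ^ m) ∧
  ∃ G : X → ℝ, (∀ x, ∀ w ∈ Icc (η x) 1, breg f (h₁ w) (h₂ w) ≤ G x) ∧
    Summable (fun x => η x * G x)

end SDRME

end

/-! The pointwise loss `b(w)` is nonnegative and vanishes only at `w = 1`. Hence the loss should be
small at the true parameter and bounded below away from it, and a minimizer, whose loss is at most
that at the true parameter, must be close to it.

Lower bound (`exists_separating_loss`): by compactness, finitely many points of the sample space
detect every parameter at distance at least `ε`. Once the empirical density is accurate at these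
points, a single term of the loss is already bounded below.

Upper bound (`tendsto_measure_le_loss`): over finitely many points, the strong law gives `w → 1` and
each term tends to `0`. The remaining points are handled by Markov's inequality, which needs a bound
on the expected terms that is summable over the points and uniform in `n` (`binoExp_div_mul_le`).
The count at a point is binomial. For `w ≤ 1` the majorant `G` and the mean of the count suffice;
for `w ≥ 1` polynomial growth of `b` reduces the bound to negative moments of the binomial law,
controlled by the size-bias identity. -/

noncomputable section

namespace SDRME

/-- The pointwise loss `b(w) = B_f{h₁(w), h₂(w)}`. -/
def pointLoss (f h₁ h₂ : ℝ → ℝ) (w : ℝ) : ℝ :=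
  breg f (h₁ w) (h₂ w)

/-! ### Positivity of the pointwise loss -/

/-- A strictly convex function lies strictly above its tangent line away from the point of tangency.
-/
theorem breg_pos {f : ℝ → ℝ} (hf : IsGenerator f) {u v : ℝ} (hu : 0 < u) (hv : 0 < v)
    (huv : u ≠ v) : 0 < breg f u v := by
  have hd : DifferentiableAt ℝ f v := hf.diff₁.differentiableAt (Ioi_mem_nhds hv)
  unfold breg
  rcases lt_or_gt_of_ne huv with h | h
  · have h1 := hf.strictConvex.slope_lt_deriv hu hv h hd
    rw [slope_def_field, div_lt_iff₀ (by linarith)] at h1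
    linarith
  · have h1 := hf.strictConvex.deriv_lt_slope hv hu h hd
    rw [slope_def_field, lt_div_iff₀ (by linarith)] at h1
    linarith

theorem breg_self (f : ℝ → ℝ) (u : ℝ) : breg f u u = 0 := by
  simp [breg]

section PointLoss

variable {f h₁ h₂ : ℝ → ℝ}

theorem pointLoss_pos (hf : IsGenerator f) (hh : IsMatchingPair h₁ h₂) {w : ℝ} (hw : 0 < w)
    (hw1 : w ≠ 1) : 0 < pointLoss f h₁ h₂ w :=
  breg_pos hf (hh.mapsTo₁ hw) (hh.mapsTo₂ hw) fun h => hw1 ((hh.eq_iff w hw).1 h)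

theorem pointLoss_one (hh : IsMatchingPair h₁ h₂) : pointLoss f h₁ h₂ 1 = 0 := by
  rw [pointLoss, (hh.eq_iff 1 one_pos).2 rfl, breg_self]

theorem pointLoss_nonneg (hf : IsGenerator f) (hh : IsMatchingPair h₁ h₂) {w : ℝ} (hw : 0 < w) :
    0 ≤ pointLoss f h₁ h₂ w := by
  by_cases h : w = 1
  · rw [h, pointLoss_one hh]
  · exact (pointLoss_pos hf hh hw h).le

theorem continuousOn_pointLoss (hf : IsGenerator f) (hh : IsMatchingPair h₁ h₂) :
    ContinuousOn (pointLoss f h₁ h₂) (Ioi 0) := by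
  have c1 := hh.diff₁.continuousOn
  have c2 := hh.diff₂.continuousOn
  unfold pointLoss breg
  exact ((hf.diff₁.continuousOn.comp c1 hh.mapsTo₁).sub
    (hf.diff₁.continuousOn.comp c2 hh.mapsTo₂)).sub
    ((hf.diff₂.continuousOn.comp c2 hh.mapsTo₂).mul (c1.sub c2))

end PointLoss

/-! ### Separation by compactness -/

/-- A loss that is continuous and vanishes only at `1` is bounded below along ratios `q / a` with
`a` close to `e` and `q` away from `e` in a compact set. -/
theorem exists_le_mul_div {b : ℝ → ℝ} (hb : ContinuousOn b (Ioi 0))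
    (hpos : ∀ w, 0 < w → w ≠ 1 → 0 < b w) {C : Set ℝ} (hC : IsCompact C) (hC0 : C ⊆ Ioi 0)
    {e ρ : ℝ} (he : 0 < e) (hρ : 0 < ρ) :
    ∃ δ > 0, ∃ r > 0, ∀ a, |a - e| < r → ∀ q ∈ C, ρ ≤ |q - e| → δ ≤ a * b (q / a) := by
  -- Half of the gap `ρ` survives when `e` is replaced by a nearby `a`. So `K` is compact and misses
  -- the diagonal, where the ratio is `1`.
  set K : Set (ℝ × ℝ) := (Icc (e / 2) (3 * e / 2) ×ˢ C) ∩ {z | ρ / 2 ≤ |z.2 - z.1|} with hK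
  have hKc : IsCompact K := (isCompact_Icc.prod hC).inter_right
    (isClosed_le continuous_const (by fun_prop))
  have hfst : ∀ z ∈ K, 0 < z.1 := fun z hz => by
    have := hz.1.1.1
    linarith
  have hsnd : ∀ z ∈ K, 0 < z.2 := fun z hz => hC0 hz.1.2
  have hcont : ContinuousOn (fun z : ℝ × ℝ => z.1 * b (z.2 / z.1)) K := by
    refine continuousOn_fst.mul (hb.comp ?_ fun z hz => div_pos (hsnd z hz) (hfst z hz))
    exact continuousOn_snd.div continuousOn_fst fun z hz => (hfst z hz).ne'
  have hmem : ∀ a, |a - e| < min (e / 2) (ρ / 2) → ∀ q ∈ C, ρ ≤ |q - e| → (a, q) ∈ K := by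
    intro a ha q hq hqe
    have h1 := ha.trans_le (min_le_left _ _)
    have h2 := ha.trans_le (min_le_right _ _)
    refine ⟨⟨?_, hq⟩, ?_⟩
    · rw [abs_lt] at h1
      constructor <;> dsimp only <;> linarith
    · have := abs_sub_le q a e
      simp only [mem_ofPred_eq]
      linarith
  refine (K.eq_empty_or_nonempty).elim (fun h0 => ?_) fun hne => ?_
  · refine ⟨1, one_pos, min (e / 2) (ρ / 2), by positivity, fun a ha q hq hqe => ?_⟩
    exact absurd (hmem a ha q hq hqe) (by simp [h0])
  · obtain ⟨z, hz, hmin⟩ := hKc.exists_isMinOn hne hcont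
    refine ⟨z.1 * b (z.2 / z.1), ?_, min (e / 2) (ρ / 2), by positivity, fun a ha q hq hqe =>
      hmin (hmem a ha q hq hqe)⟩
    refine mul_pos (hfst z hz) (hpos _ (div_pos (hsnd z hz) (hfst z hz)) fun h => ?_)
    rw [div_eq_one_iff_eq (hfst z hz).ne'] at h
    have h3 : ρ / 2 ≤ |z.2 - z.1| := hz.2
    rw [h, sub_self, abs_zero] at h3
    linarith

/-- Over a compact parameter set, finitely many points separate the parameters at a distance at
least `ε` from the true one. -/
theorem exists_finset_separating {X A : Type*} [PseudoMetricSpace A] {T : Set A} (hT : IsCompact T)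
    {q : A → X → ℝ} (hq : ∀ x, ContinuousOn (fun τ => q τ x) T) {η : X → ℝ} {τ₀ : A}
    (hid : ∀ τ ∈ T, (∀ x, q τ x = η x) → τ = τ₀) {ε : ℝ} (hε : 0 < ε) :
    ∃ F : Finset X, ∃ ρ > 0, ∀ τ ∈ T, ε ≤ dist τ τ₀ → ∃ x ∈ F, ρ ≤ |q τ x - η x| := by
  have hK : IsCompact (T ∩ {τ | ε ≤ dist τ τ₀}) :=
    hT.inter_right (isClosed_le continuous_const (by fun_prop))
  have key : ∃ F : Finset X, ∃ ρ > 0, ∀ τ ∈ T ∩ {τ | ε ≤ dist τ τ₀},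
      ∃ x ∈ F, ρ ≤ |q τ x - η x| := by
    -- The property passes to subsets and finite unions, so it need only hold near each parameter,
    -- where one point and half of its gap suffice.
    refine hK.induction_on (p := fun s => ∃ F : Finset X, ∃ ρ > 0, ∀ τ ∈ s,
      ∃ x ∈ F, ρ ≤ |q τ x - η x|) ⟨∅, 1, one_pos, by simp⟩ ?_ ?_ ?_
    · rintro s t hst ⟨F, ρ, hρ, h⟩
      exact ⟨F, ρ, hρ, fun τ hτ => h τ (hst hτ)⟩
    · classical
      rintro s t ⟨F, ρ, hρ, h⟩ ⟨F', ρ', hρ', h'⟩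
      refine ⟨F ∪ F', min ρ ρ', lt_min hρ hρ', ?_⟩
      rintro τ (hτ | hτ)
      · obtain ⟨x, hx, hle⟩ := h τ hτ
        exact ⟨x, Finset.mem_union_left _ hx, (min_le_left _ _).trans hle⟩
      · obtain ⟨x, hx, hle⟩ := h' τ hτ
        exact ⟨x, Finset.mem_union_right _ hx, (min_le_right _ _).trans hle⟩
    · rintro τ ⟨hτ, hτε⟩
      have hne : τ ≠ τ₀ := by
        rintro rfl
        simp only [mem_ofPred_eq, dist_self] at hτε
        linarith
      obtain ⟨x, hx⟩ : ∃ x, q τ x ≠ η x := by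
        by_contra! hcon
        exact hne (hid τ hτ hcon)
      have hpos : 0 < |q τ x - η x| := abs_pos.2 (sub_ne_zero.2 hx)
      have hc : ContinuousWithinAt (fun σ => |q σ x - η x|) (T ∩ {τ | ε ≤ dist τ τ₀}) τ :=
        (((hq x).sub continuousOn_const).abs τ hτ).mono inter_subset_left
      refine ⟨_, hc.eventually (lt_mem_nhds (half_lt_self hpos)), {x}, _, half_pos hpos, ?_⟩
      exact fun σ hσ => ⟨x, Finset.mem_singleton_self x, le_of_lt hσ⟩
  obtain ⟨F, ρ, hρ, h⟩ := key
  exact ⟨F, ρ, hρ, fun τ hτ hd => h τ ⟨hτ, hd⟩⟩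

/-! ### Negative moments of the binomial distribution -/

/-- The expectation of `φ` under the binomial distribution with parameters `n` and `e`. -/
def binoExp (e : ℝ) : ℕ → (ℕ → ℝ) → ℝ
  | 0, φ => φ 0
  | n + 1, φ => e * binoExp e n (fun j => φ (j + 1)) + (1 - e) * binoExp e n φ

theorem binoExp_mono {e : ℝ} (h0 : 0 ≤ e) (h1 : e ≤ 1) (n : ℕ) {φ ψ : ℕ → ℝ}
    (h : ∀ j ≤ n, φ j ≤ ψ j) : binoExp e n φ ≤ binoExp e n ψ := by
  induction n generalizing φ ψ with
  | zero => exact h 0 le_rfl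
  | succ n ih =>
    have h1' : 0 ≤ 1 - e := by linarith
    simp only [binoExp]
    gcongr
    · exact ih fun j hj => h _ (by omega)
    · exact ih fun j hj => h _ (by omega)

theorem binoExp_add_mul (e : ℝ) (n : ℕ) (φ ψ : ℕ → ℝ) (c c' : ℝ) :
    binoExp e n (fun j => c * φ j + c' * ψ j) = c * binoExp e n φ + c' * binoExp e n ψ := by
  induction n generalizing φ ψ with
  | zero => rfl
  | succ n ih =>
    simp only [binoExp]
    rw [ih, ih]
    ring

theorem binoExp_const (e : ℝ) (n : ℕ) (c : ℝ) : binoExp e n (fun _ => c) = c := by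
  induction n with
  | zero => rfl
  | succ n ih =>
    simp only [binoExp]
    rw [ih]
    ring

theorem binoExp_nonneg {e : ℝ} (h0 : 0 ≤ e) (h1 : e ≤ 1) (n : ℕ) {φ : ℕ → ℝ}
    (h : ∀ j ≤ n, 0 ≤ φ j) : 0 ≤ binoExp e n φ :=
  (binoExp_const e n 0).symm.le.trans (binoExp_mono h0 h1 n h)

/-- The size-bias identity of the binomial distribution. -/
theorem binoExp_succ_mul (e : ℝ) (n : ℕ) (ψ : ℕ → ℝ) :
    binoExp e (n + 1) (fun j => j * ψ j) = (n + 1) * e * binoExp e n (fun j => ψ (j + 1)) := by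
  induction n generalizing ψ with
  | zero => simp [binoExp]
  | succ n ih =>
    have h1 : (fun j : ℕ => ((j + 1 : ℕ) : ℝ) * ψ (j + 1)) =
        fun j : ℕ => 1 * ((j : ℝ) * ψ (j + 1)) + 1 * ψ (j + 1) := by
      funext j
      push_cast
      ring
    have h3 : binoExp e (n + 1) (fun j => ψ (j + 1)) =
      e * binoExp e n (fun j => ψ (j + 1 + 1)) + (1 - e) * binoExp e n (fun j => ψ (j + 1)) := rfl
    rw [binoExp, h1, binoExp_add_mul, ih, ih ψ, h3]
    push_cast
    ring

/-- `1 / ((j + 1) ⋯ (j + k))`. -/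
def invRising (k j : ℕ) : ℝ :=
  ∏ i ∈ Finset.range k, ((j : ℝ) + i + 1)⁻¹

theorem invRising_nonneg (k j : ℕ) : 0 ≤ invRising k j :=
  Finset.prod_nonneg fun i _ => by positivity

/-- Each application of the size-bias identity trades a factor `n * e` for one factor of the rising
product, at the cost of raising `n` by one. -/
theorem binoExp_invRising_le {e : ℝ} (h0 : 0 ≤ e) (h1 : e ≤ 1) (k n : ℕ) :
    (n * e) ^ k * binoExp e n (invRising k) ≤ 1 := by
  induction k generalizing n with
  | zero =>
    have : invRising 0 = fun _ => 1 := by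
      funext j
      simp [invRising]
    rw [this, binoExp_const]
    simp
  | succ k ih =>
    -- Shifting `ψ` by one gives `invRising (k + 1)`, while `j * ψ j` is `invRising k j` for `j ≥ 1`
    -- and `0` for `j = 0`.
    set ψ : ℕ → ℝ := fun j => ∏ i ∈ Finset.range (k + 1), ((j : ℝ) + i)⁻¹ with hψ
    have hψ1 : (fun j => ψ (j + 1)) = invRising (k + 1) := by
      funext j
      simp only [hψ, invRising]
      refine Finset.prod_congr rfl fun i _ => ?_
      push_cast
      ring
    have hψ2 : ∀ j : ℕ, (j : ℝ) * ψ j ≤ invRising k j := by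
      intro j
      simp only [hψ, invRising, Finset.prod_range_succ']
      have h3 : (j : ℝ) * ((j : ℝ) + (0 : ℕ))⁻¹ ≤ 1 := by
        simpa using mul_inv_le_one
      have h4 : ∏ i ∈ Finset.range k, ((j : ℝ) + (i + 1 : ℕ))⁻¹ =
          ∏ i ∈ Finset.range k, ((j : ℝ) + i + 1)⁻¹ := by
        refine Finset.prod_congr rfl fun i _ => ?_
        push_cast
        ring
      rw [h4]
      have h5 := invRising_nonneg k j
      unfold invRising at h5
      nlinarith
    have hsb := binoExp_succ_mul e n ψ
    rw [hψ1] at hsb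
    have hle := binoExp_mono h0 h1 (n + 1) (fun j _ => hψ2 j)
    have hnn := binoExp_nonneg h0 h1 n (fun j _ => invRising_nonneg (k + 1) j)
    calc ((n : ℝ) * e) ^ (k + 1) * binoExp e n (invRising (k + 1))
        = (n * e) ^ k * (n * e * binoExp e n (invRising (k + 1))) := by ring
      _ ≤ ((n + 1 : ℕ) * e) ^ k * ((n + 1) * e * binoExp e n (invRising (k + 1))) := by
          push_cast
          gcongr <;> linarith
      _ ≤ ((n + 1 : ℕ) * e) ^ k * binoExp e (n + 1) (invRising k) := by
          rw [← hsb]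
          gcongr
      _ ≤ 1 := ih (n + 1)

/-- Compares factor by factor, using `j + k + 1 ≤ (k + 2) * j` for `j ≥ 1`. -/
theorem inv_pow_le_invRising (k : ℕ) {j : ℕ} (hj : 1 ≤ j) :
    ((j : ℝ)⁻¹) ^ k ≤ ((k + 1).factorial : ℝ) * invRising k j := by
  have hj' : (1 : ℝ) ≤ j := by exact_mod_cast hj
  induction k with
  | zero => simp [invRising]
  | succ k ih =>
    have hr : invRising (k + 1) j = invRising k j * ((j : ℝ) + k + 1)⁻¹ := by
      exact Finset.prod_range_succ _ _
    have h1 : (j : ℝ)⁻¹ ≤ ((k + 2 : ℕ) : ℝ) * ((j : ℝ) + k + 1)⁻¹ := by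
      rw [← div_eq_mul_inv, le_div_iff₀ (by positivity), inv_mul_le_iff₀ (by positivity)]
      push_cast
      nlinarith [(Nat.cast_nonneg k : (0 : ℝ) ≤ k)]
    calc ((j : ℝ)⁻¹) ^ (k + 1) = ((j : ℝ)⁻¹) ^ k * (j : ℝ)⁻¹ := pow_succ _ _
      _ ≤ (((k + 1).factorial : ℝ) * invRising k j) *
          (((k + 2 : ℕ) : ℝ) * ((j : ℝ) + k + 1)⁻¹) := by
          have := invRising_nonneg k j
          gcongr
      _ = _ := by
          rw [hr, Nat.factorial_succ (k + 1)]
          push_cast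
          ring

theorem binoExp_id (e : ℝ) (n : ℕ) : binoExp e n (fun j => (j : ℝ)) = n * e := by
  cases n with
  | zero => simp [binoExp]
  | succ n =>
    have := binoExp_succ_mul e n (fun _ => 1)
    simp only [mul_one, binoExp_const] at this
    rw [this]
    push_cast
    ring

/-- The contribution `p_n(x) b(η(x) / p_n(x))` of a point of density `e` to the loss at the true
parameter has expectation of order `e`. -/
theorem binoExp_div_mul_le {b : ℝ → ℝ} {K g e : ℝ} {m : ℕ} (he : 0 < e) (he1 : e ≤ 1)
    (hK : ∀ w, 1 ≤ w → b w ≤ K * w ^ m) (hg : ∀ w ∈ Icc e 1, b w ≤ g) {n : ℕ} (hn : 1 ≤ n) :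
    binoExp e n (fun j => (j / n : ℝ) * b (e / (j / n : ℝ))) ≤
      e * |g| + |K| * (m + 1).factorial * e := by
  have hn' : (0 : ℝ) < n := by exact_mod_cast hn
  -- The first term covers ratios at most `1`, the second ratios at least `1`; both are nonnegative,
  -- so their sum covers all. An unseen point, `j = 0`, has weight zero.
  have hmaj : ∀ j ≤ n, (j / n : ℝ) * b (e / (j / n : ℝ)) ≤
      (|g| / n) * (j : ℝ) + (|K| * e * (m + 1).factorial * (n * e) ^ m) * invRising m j := by
    intro j hjn
    have hr := invRising_nonneg m j
    rcases Nat.eq_zero_or_pos j with rfl | hj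
    · simp only [Nat.cast_zero, zero_div, zero_mul, mul_zero, zero_add]
      positivity
    have hj' : (0 : ℝ) < j := by exact_mod_cast hj
    have hjn' : (j : ℝ) ≤ n := by exact_mod_cast hjn
    have ha : (0 : ℝ) < j / n := by positivity
    have ha1 : (j / n : ℝ) ≤ 1 := (div_le_one hn').2 hjn'
    rcases le_total 1 (e / (j / n : ℝ)) with hw | hw
    · have h1 : b (e / (j / n : ℝ)) ≤ |K| * (e / (j / n : ℝ)) ^ (m + 1) := by
        refine (hK _ hw).trans ?_
        have := pow_le_pow_right₀ hw (Nat.le_succ m)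
        gcongr
        exact le_abs_self K
      calc (j / n : ℝ) * b (e / (j / n : ℝ))
          ≤ (j / n : ℝ) * (|K| * (e / (j / n : ℝ)) ^ (m + 1)) := by gcongr
        _ = |K| * e * (n * e) ^ m * ((j : ℝ)⁻¹) ^ m := by
            rw [pow_succ, show e / (j / n : ℝ) = n * e * (j : ℝ)⁻¹ by field_simp, mul_pow]
            field_simp
        _ ≤ |K| * e * (n * e) ^ m * (((m + 1).factorial : ℝ) * invRising m j) := by
            gcongr
            exact inv_pow_le_invRising m hj
        _ = (|K| * e * (m + 1).factorial * (n * e) ^ m) * invRising m j := by ring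
        _ ≤ _ := le_add_of_nonneg_left (by positivity)
    -- Since `j / n ≤ 1`, the ratio is at least `e`, hence in the range of `hg`.
    · have h1 : b (e / (j / n : ℝ)) ≤ |g| := by
        refine (hg _ ⟨?_, hw⟩).trans (le_abs_self g)
        rw [le_div_iff₀ ha]
        nlinarith
      calc (j / n : ℝ) * b (e / (j / n : ℝ)) ≤ (j / n : ℝ) * |g| := by gcongr
        _ = (|g| / n) * (j : ℝ) := by ring
        _ ≤ _ := le_add_of_nonneg_right (by positivity)
  refine (binoExp_mono he.le he1 n hmaj).trans ?_
  rw [binoExp_add_mul, binoExp_id]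
  have h2 := binoExp_invRising_le he.le he1 m n
  have h3 : |g| / n * (n * e) = e * |g| := by field_simp
  rw [h3]
  have h4 : |K| * e * (m + 1).factorial * ((n * e) ^ m * binoExp e n (invRising m)) ≤
      |K| * e * (m + 1).factorial * 1 := by gcongr
  linarith

/-! ### Law of the counts and strong law -/

section Sampling

open Classical in
/-- The number of the first `n` terms of the sample `s` that are equal to `x`. -/
def sampleCount {X : Type*} (s : ℕ → X) (n : ℕ) (x : X) : ℕ :=
  ∑ i ∈ Finset.range n, if s i = x then 1 else 0

theorem empDensity_eq_sampleCount {X : Type*} (s : ℕ → X) (n : ℕ) (x : X) :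
    empDensity s n x = (sampleCount s n x : ℝ) / n := by
  classical
  rw [empDensity, sampleCount, Finset.card_filter]

theorem empDensity_nonneg {X : Type*} (s : ℕ → X) (n : ℕ) (x : X) : 0 ≤ empDensity s n x := by
  unfold empDensity
  positivity

variable {X : Type*} [MeasurableSpace X] [DiscreteMeasurableSpace X] {Ω : Type*}
  [MeasurableSpace Ω] {P : Measure Ω} {ξ : ℕ → Ω → X}

theorem measurable_sampleCount (hξ : ∀ i, Measurable (ξ i)) (n : ℕ) (x : X) :
    Measurable fun ω => sampleCount (fun i => ξ i ω) n x := by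
  classical
  unfold sampleCount
  refine Finset.measurable_fun_sum _ fun i _ => ?_
  exact (Measurable.of_discrete (f := fun y : X => if y = x then 1 else 0)).comp (hξ i)

theorem measurable_comp_empDensity (hξ : ∀ i, Measurable (ξ i)) (n : ℕ) (x : X) (g : ℝ → ℝ) :
    Measurable fun ω => g (empDensity (fun i => ξ i ω) n x) := by
  simp_rw [empDensity_eq_sampleCount]
  exact (Measurable.of_discrete (f := fun j : ℕ => g ((j : ℝ) / n))).comp
    (measurable_sampleCount hξ n x)

open Classical in
theorem indepFun_sampleCount (hξ : ∀ i, Measurable (ξ i)) (hind : iIndepFun ξ P) (n : ℕ) (x : X) :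
    IndepFun (fun ω => sampleCount (fun i => ξ i ω) n x)
      (fun ω => if ξ n ω = x then 1 else 0 : Ω → ℕ) P := by
  have hg : Measurable (fun y : X => if y = x then 1 else 0 : X → ℕ) := .of_discrete
  have h := (hind.comp (fun _ => fun y : X => if y = x then 1 else 0) fun _ => hg)
    |>.indepFun_sum_range_succ (fun i => hg.comp (hξ i)) n
  refine h.congr (.of_forall fun ω => ?_) (.of_forall fun ω => rfl)
  simp [sampleCount]

/-- Splitting on whether the last observation equals `x`, which is independent of the earlier count,
reproduces the recursion of `binoExp`. -/
theorem lintegral_sampleCount [IsProbabilityMeasure P] (hξ : ∀ i, Measurable (ξ i))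
    (hind : iIndepFun ξ P) (x : X) {e : ℝ} (h0 : 0 ≤ e) (h1 : e ≤ 1)
    (hlaw : ∀ i, P (ξ i ⁻¹' {x}) = ENNReal.ofReal e) (n : ℕ) {φ : ℕ → ℝ} (hφ : ∀ j, 0 ≤ φ j) :
    ∫⁻ ω, ENNReal.ofReal (φ (sampleCount (fun i => ξ i ω) n x)) ∂P =
      ENNReal.ofReal (binoExp e n φ) := by
  classical
  induction n generalizing φ with
  | zero => simp [sampleCount, binoExp]
  | succ n ih =>
    set N : Ω → ℕ := fun ω => sampleCount (fun i => ξ i ω) n x with hN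
    set Y : Ω → ℕ := fun ω => if ξ n ω = x then 1 else 0 with hY
    have hNm : Measurable N := measurable_sampleCount hξ n x
    have hYm : Measurable Y :=
      (Measurable.of_discrete (f := fun y : X => if y = x then 1 else 0)).comp (hξ n)
    have hNY : IndepFun N Y P := indepFun_sampleCount hξ hind n x
    have hA : MeasurableSet (ξ n ⁻¹' {x}) := hξ n (.of_discrete)
    have hY1 : ∫⁻ ω, (Y ω : ENNReal) ∂P = ENNReal.ofReal e := by
      rw [← hlaw n, ← lintegral_indicator_one hA]
      refine lintegral_congr fun ω => ?_
      by_cases h : ξ n ω = x <;> simp [hY, h]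
    have hY2 : ∫⁻ ω, ((1 - Y ω : ℕ) : ENNReal) ∂P = ENNReal.ofReal (1 - e) := by
      rw [ENNReal.ofReal_sub _ h0, ENNReal.ofReal_one, ← hlaw n, ← prob_compl_eq_one_sub hA,
        ← lintegral_indicator_one hA.compl]
      refine lintegral_congr fun ω => ?_
      by_cases h : ξ n ω = x <;> simp [hY, h]
    have hsplit : ∀ ω, ENNReal.ofReal (φ (sampleCount (fun i => ξ i ω) (n + 1) x)) =
        ENNReal.ofReal (φ (N ω + 1)) * (Y ω : ENNReal) +
          ENNReal.ofReal (φ (N ω)) * ((1 - Y ω : ℕ) : ENNReal) := by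
      intro ω
      have hs : sampleCount (fun i => ξ i ω) (n + 1) x = N ω + Y ω := Finset.sum_range_succ _ _
      rw [hs]
      by_cases h : ξ n ω = x <;> simp [hY, h]
    have hm : ∀ g : ℕ → ENNReal, Measurable g := fun g => .of_discrete
    have hmul : ∀ g k : ℕ → ENNReal,
        ∫⁻ ω, g (N ω) * k (Y ω) ∂P = (∫⁻ ω, g (N ω) ∂P) * ∫⁻ ω, k (Y ω) ∂P := fun g k =>
      lintegral_mul_eq_lintegral_mul_lintegral_of_indepFun'' ((hm g).comp hNm).aemeasurable
        ((hm k).comp hYm).aemeasurable (hNY.comp (hm g) (hm k))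
    have hmeas : Measurable fun ω => ENNReal.ofReal (φ (N ω + 1)) * (Y ω : ENNReal) :=
      ((hm fun j => ENNReal.ofReal (φ (j + 1))).comp hNm).mul
        ((hm fun j => (j : ENNReal)).comp hYm)
    simp_rw [hsplit]
    rw [lintegral_add_left hmeas,
      hmul (fun j => ENNReal.ofReal (φ (j + 1))) (fun j => (j : ENNReal)),
      hmul (fun j => ENNReal.ofReal (φ j)) (fun j => ((1 - j : ℕ) : ENNReal)), hY1, hY2,
      ih (φ := fun j => φ (j + 1)) fun j => hφ _, ih hφ,
      ← ENNReal.ofReal_mul' h0, ← ENNReal.ofReal_mul' (by linarith), ← ENNReal.ofReal_add]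
    · simp only [binoExp]
      congr 1
      ring
    · exact mul_nonneg (binoExp_nonneg h0 h1 n fun j _ => hφ _) h0
    · exact mul_nonneg (binoExp_nonneg h0 h1 n fun j _ => hφ _) (by linarith)

/-- The strong law of large numbers for the empirical density. -/
theorem ae_tendsto_empDensity [IsProbabilityMeasure P] (hξ : ∀ i, Measurable (ξ i))
    (hind : iIndepFun ξ P) (x : X) {e : ℝ} (h0 : 0 ≤ e)
    (hident : ∀ i, P.map (ξ i) = P.map (ξ 0)) (hlaw : P (ξ 0 ⁻¹' {x}) = ENNReal.ofReal e) :
    ∀ᵐ ω ∂P, Tendsto (fun n => empDensity (fun i => ξ i ω) n x) atTop (𝓝 e) := by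
  classical
  set g : X → ℝ := fun y => if y = x then 1 else 0 with hg
  have hgm : Measurable g := .of_discrete
  have hA : MeasurableSet (ξ 0 ⁻¹' {x}) := hξ 0 (.of_discrete)
  have hgi : (fun ω => g (ξ 0 ω)) = (ξ 0 ⁻¹' {x}).indicator 1 := by
    funext ω
    by_cases h : ξ 0 ω = x <;> simp [hg, h]
  have hmean : ∫ ω, g (ξ 0 ω) ∂P = e := by
    rw [hgi, integral_indicator_one hA, measureReal_def, hlaw, ENNReal.toReal_ofReal h0]
  have hint : Integrable (fun ω => g (ξ 0 ω)) P := by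
    rw [hgi]
    exact (integrable_const 1).indicator hA
  have h := strong_law_ae_real (fun i ω => g (ξ i ω)) hint
    (fun i j hij => (hind.indepFun hij).comp hgm hgm) fun i =>
    (IdentDistrib.mk (hξ i).aemeasurable (hξ 0).aemeasurable (hident i)).comp hgm
  filter_upwards [h] with ω hω
  rw [hmean] at hω
  refine hω.congr fun n => ?_
  rw [empDensity_eq_sampleCount, sampleCount]
  push_cast
  rfl

end Sampling

/-! ### Bounds on the empirical loss -/

section Loss

variable {X : Type*}

theorem hasFiniteSupport_empDensity (s : ℕ → X) (n : ℕ) :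
    (Function.support (empDensity s n)).Finite := by
  classical
  refine ((Finset.range n).image s).finite_toSet.subset fun x hx => ?_
  by_contra hcon
  refine hx ?_
  have : (Finset.range n).filter (fun i => s i = x) = ∅ := by
    refine Finset.filter_eq_empty_iff.2 fun i hi h => hcon ?_
    exact Finset.mem_coe.2 (Finset.mem_image.2 ⟨i, hi, h⟩)
  unfold empDensity
  convert! zero_div (n : ℝ)
  simpa using this

theorem summable_empDensity_mul (s : ℕ → X) (n : ℕ) (g : X → ℝ) :
    Summable fun x => empDensity s n x * g x :=
  summable_of_hasFiniteSupport <| (hasFiniteSupport_empDensity s n).subset fun _ hx h =>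
    hx (by simp [h])

variable {d : ℕ} {f h₁ h₂ : ℝ → ℝ} {p : X → EuclideanSpace ℝ (Fin d) → ℝ}

theorem loss_eq_tsum (s : ℕ → X) (n : ℕ) (τ : Param d) :
    loss f h₁ h₂ p s n τ =
      ∑' x, empDensity s n x * pointLoss f h₁ h₂ (extModel p τ x / empDensity s n x) :=
  rfl

theorem empDensity_mul_pointLoss_nonneg (hf : IsGenerator f) (hh : IsMatchingPair h₁ h₂)
    (s : ℕ → X) (n : ℕ) {q : ℝ} (hq : 0 < q) (x : X) :
    0 ≤ empDensity s n x * pointLoss f h₁ h₂ (q / empDensity s n x) := by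
  rcases (empDensity_nonneg s n x).eq_or_lt with h | h
  · rw [← h, zero_mul]
  · exact mul_nonneg h.le (pointLoss_nonneg hf hh (div_pos hq h))

theorem le_loss (hf : IsGenerator f) (hh : IsMatchingPair h₁ h₂) (s : ℕ → X) (n : ℕ) {τ : Param d}
    (hτ : ∀ x, 0 < extModel p τ x) (x : X) :
    empDensity s n x * pointLoss f h₁ h₂ (extModel p τ x / empDensity s n x) ≤
      loss f h₁ h₂ p s n τ :=
  (summable_empDensity_mul s n _).le_tsum x fun y _ =>
    empDensity_mul_pointLoss_nonneg hf hh s n (hτ y) y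

theorem ofReal_loss (hf : IsGenerator f) (hh : IsMatchingPair h₁ h₂) (s : ℕ → X) (n : ℕ)
    {τ : Param d} (hτ : ∀ x, 0 < extModel p τ x) :
    ENNReal.ofReal (loss f h₁ h₂ p s n τ) =
      ∑' x, ENNReal.ofReal
        (empDensity s n x * pointLoss f h₁ h₂ (extModel p τ x / empDensity s n x)) := by
  rw [loss_eq_tsum]
  exact ENNReal.ofReal_tsum_of_nonneg
    (fun y => empDensity_mul_pointLoss_nonneg hf hh s n (hτ y) y) (summable_empDensity_mul s n _)

/-- Parameters away from the true one have a loss bounded away from zero, as soon as the empirical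
density is close to the true density at finitely many points. -/
theorem exists_separating_loss (hf : IsGenerator f) (hh : IsMatchingPair h₁ h₂)
    {T : Set (Param d)} (hT : IsCompact T) (hpos : ∀ τ ∈ T, ∀ x, 0 < extModel p τ x)
    (hcont : ∀ x, ContinuousOn (fun τ => extModel p τ x) T) {η : X → ℝ} (hη : ∀ x, 0 < η x)
    {τ₀ : Param d} (hid : ∀ τ ∈ T, (∀ x, extModel p τ x = η x) → τ = τ₀) {ε : ℝ} (hε : 0 < ε) :
    ∃ F : Finset X, ∃ r δ : X → ℝ, (∀ x, 0 < r x) ∧ (∀ x, 0 < δ x) ∧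
      ∀ (s : ℕ → X) (n : ℕ), (∀ x ∈ F, |empDensity s n x - η x| < r x) →
        ∀ τ ∈ T, ε ≤ dist τ τ₀ → ∃ x ∈ F, δ x ≤ loss f h₁ h₂ p s n τ := by
  obtain ⟨F, ρ, hρ, hF⟩ := exists_finset_separating (q := extModel p) hT hcont hid hε
  have h : ∀ x, ∃ δ > 0, ∃ r > 0, ∀ a, |a - η x| < r →
      ∀ q ∈ (fun τ => extModel p τ x) '' T, ρ ≤ |q - η x| →
        δ ≤ a * pointLoss f h₁ h₂ (q / a) := fun x =>
    exists_le_mul_div (continuousOn_pointLoss hf hh) (fun w hw hw1 => pointLoss_pos hf hh hw hw1)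
      (hT.image_of_continuousOn (hcont x)) (by rintro _ ⟨τ, hτ, rfl⟩; exact hpos τ hτ x)
      (hη x) hρ
  choose δ hδ r hr h using h
  refine ⟨F, r, δ, hr, hδ, fun s n hs τ hτ hd => ?_⟩
  obtain ⟨x, hx, hρx⟩ := hF τ hτ hd
  exact ⟨x, hx, (h x _ (hs x hx) _ ⟨τ, hτ, rfl⟩ hρx).trans (le_loss hf hh s n (hpos τ hτ) x)⟩

end Loss

/-! ### The loss at the true parameter -/

section Convergence

variable {X : Type*} [Countable X] [MeasurableSpace X] [DiscreteMeasurableSpace X] {d : ℕ}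
  {f h₁ h₂ : ℝ → ℝ} {p : X → EuclideanSpace ℝ (Fin d) → ℝ} {τ₀ : Param d}
  {Ω : Type*} [MeasurableSpace Ω] {P : Measure Ω} {ξ : ℕ → Ω → X}

/-- The total expectation of the contributions to the loss outside a finite set is uniformly
small. -/
theorem exists_finset_tsum_lintegral_le [IsProbabilityMeasure P] (hf : IsGenerator f)
    (hh : IsMatchingPair h₁ h₂) (hξ : ∀ i, Measurable (ξ i)) (hind : iIndepFun ξ P) {η : X → ℝ}
    (hη : ∀ x, 0 < η x) (hη1 : HasSum η 1)
    (hlaw : ∀ i x, P (ξ i ⁻¹' {x}) = ENNReal.ofReal (η x))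
    (htail : Infinite X → TailIntegrable f h₁ h₂ η) {c : ENNReal} (hc : 0 < c) :
    ∃ F : Finset X, ∀ n, 1 ≤ n → ∑' x : {x // x ∉ F}, ∫⁻ ω, ENNReal.ofReal
      (empDensity (fun i => ξ i ω) n x *
        pointLoss f h₁ h₂ (η x / empDensity (fun i => ξ i ω) n x)) ∂P ≤ c := by
  rcases finite_or_infinite X with hX | hX
  · have := Fintype.ofFinite X
    refine ⟨Finset.univ, fun n _ => ?_⟩
    have : IsEmpty {x : X // x ∉ Finset.univ} := ⟨fun x => x.2 (Finset.mem_univ _)⟩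
    simp
  obtain ⟨⟨K, m, hK⟩, G, hG, hGs⟩ := htail hX
  have hle1 : ∀ x, η x ≤ 1 := fun x => le_hasSum hη1 x fun y _ => (hη y).le
  have hsum : Summable fun x => η x * |G x| + |K| * (m + 1).factorial * η x := by
    refine Summable.add ?_ (hη1.summable.mul_left _)
    refine hGs.abs.congr fun x => ?_
    rw [abs_mul, abs_of_pos (hη x)]
  have hterm : ∀ n, 1 ≤ n → ∀ x, ∫⁻ ω, ENNReal.ofReal (empDensity (fun i => ξ i ω) n x *
        pointLoss f h₁ h₂ (η x / empDensity (fun i => ξ i ω) n x)) ∂P ≤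
      ENNReal.ofReal (η x * |G x| + |K| * (m + 1).factorial * η x) := by
    intro n hn x
    simp_rw [empDensity_eq_sampleCount]
    rw [lintegral_sampleCount hξ hind x (hη x).le (hle1 x) (fun i => hlaw i x) n
      (φ := fun j => (j / n : ℝ) * pointLoss f h₁ h₂ (η x / (j / n : ℝ)))]
    · exact ENNReal.ofReal_le_ofReal (binoExp_div_mul_le (hη x) (hle1 x) hK (hG x) hn)
    · intro j
      rcases Nat.eq_zero_or_pos j with rfl | hj
      · simp
      · have h1 : (0 : ℝ) < j / n := by positivity
        exact mul_nonneg h1.le (pointLoss_nonneg hf hh (div_pos (hη x) h1))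
  obtain ⟨F, hF⟩ := ((ENNReal.tendsto_tsum_compl_atTop_zero hsum.tsum_ofReal_ne_top).eventually
    (ge_mem_nhds hc)).exists
  exact ⟨F, fun n hn => (ENNReal.tsum_le_tsum fun x : {x // x ∉ F} => hterm n hn x).trans hF⟩

/-- The loss at the true parameter tends to zero in probability. -/
theorem tendsto_measure_le_loss [IsProbabilityMeasure P] (hf : IsGenerator f)
    (hh : IsMatchingPair h₁ h₂) (hξ : ∀ i, Measurable (ξ i)) (hind : iIndepFun ξ P)
    (hpos : ∀ x, 0 < extModel p τ₀ x) (hsum : HasSum (extModel p τ₀) 1)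
    (hlaw : ∀ i x, P (ξ i ⁻¹' {x}) = ENNReal.ofReal (extModel p τ₀ x))
    (hlim : ∀ x, ∀ᵐ ω ∂P,
      Tendsto (fun n => empDensity (fun i => ξ i ω) n x) atTop (𝓝 (extModel p τ₀ x)))
    (htail : Infinite X → TailIntegrable f h₁ h₂ (extModel p τ₀)) {δ : ℝ} (hδ : 0 < δ) :
    Tendsto (fun n => P {ω | δ ≤ loss f h₁ h₂ p (fun i => ξ i ω) n τ₀}) atTop (𝓝 0) := by
  set t : ℕ → X → Ω → ℝ := fun n x ω => empDensity (fun i => ξ i ω) n x *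
    pointLoss f h₁ h₂ (extModel p τ₀ x / empDensity (fun i => ξ i ω) n x) with ht
  have htm : ∀ n x, Measurable (t n x) := fun n x =>
    measurable_comp_empDensity hξ n x fun a => a * pointLoss f h₁ h₂ (extModel p τ₀ x / a)
  have ht0 : ∀ n x ω, 0 ≤ t n x ω := fun n x ω =>
    empDensity_mul_pointLoss_nonneg hf hh _ n (hpos x) x
  have htlim : ∀ x, ∀ᵐ ω ∂P, Tendsto (fun n => t n x ω) atTop (𝓝 0) := by
    intro x
    filter_upwards [hlim x] with ω hω
    have hb : ContinuousAt (pointLoss f h₁ h₂) (extModel p τ₀ x / extModel p τ₀ x) :=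
      (continuousOn_pointLoss hf hh).continuousAt (Ioi_mem_nhds (div_pos (hpos x) (hpos x)))
    have h := hω.mul (hb.tendsto.comp (tendsto_const_nhds.div hω (hpos x).ne'))
    rwa [div_self (hpos x).ne', pointLoss_one hh, mul_zero] at h
  refine ENNReal.tendsto_nhds_zero.2 fun ε hε => ?_
  have hδ2 : ENNReal.ofReal (δ / 2) ≠ 0 := (ENNReal.ofReal_pos.2 (half_pos hδ)).ne'
  have hε2 : 0 < ε / 2 := ENNReal.half_pos hε.ne'
  -- With this bound on the expected tail, Markov's inequality at level `δ / 2` leaves probability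
  -- at most `ε / 2`.
  obtain ⟨F, hF⟩ := exists_finset_tsum_lintegral_le hf hh hξ hind hpos hsum hlaw htail
    (c := ENNReal.ofReal (δ / 2) * (ε / 2)) (pos_iff_ne_zero.2 (mul_ne_zero hδ2 hε2.ne'))
  have hhead : Tendsto (fun n => P {ω | δ / 2 ≤ ∑ x ∈ F, t n x ω}) atTop (𝓝 0) := by
    have h : TendstoInMeasure P (fun n ω => ∑ x ∈ F, t n x ω) atTop fun _ => 0 := by
      refine tendstoInMeasure_of_tendsto_ae
        (fun n => (Finset.measurable_fun_sum F fun x _ => htm n x).aestronglyMeasurable) ?_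
      filter_upwards [ae_all_iff.2 htlim] with ω hω
      simpa using tendsto_finsetSum F fun x _ => hω x
    refine (tendstoInMeasure_iff_norm.1 h (δ / 2) (half_pos hδ)).congr fun n => ?_
    congr 1
    ext ω
    simp only [mem_ofPred_eq, sub_zero, Real.norm_eq_abs]
    rw [abs_of_nonneg (Finset.sum_nonneg fun x _ => ht0 n x ω)]
  filter_upwards [ENNReal.tendsto_nhds_zero.1 hhead (ε / 2) hε2, eventually_ge_atTop 1] with
    n hn hn1
  set R : Ω → ENNReal := fun ω => ∑' x : {x // x ∉ F}, ENNReal.ofReal (t n x ω)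
  have hRint : ∫⁻ ω, R ω ∂P ≤ ENNReal.ofReal (δ / 2) * (ε / 2) := by
    rw [lintegral_tsum fun x : {x // x ∉ F} => (htm n x).ennreal_ofReal.aemeasurable]
    exact hF n hn1
  have htailP : P {ω | ENNReal.ofReal (δ / 2) ≤ R ω} ≤ ε / 2 := by
    refine (meas_ge_le_lintegral_div (Measurable.tsum fun x : {x // x ∉ F} =>
      (htm n x).ennreal_ofReal).aemeasurable hδ2 ENNReal.ofReal_ne_top).trans ?_
    refine ENNReal.div_le_of_le_mul ?_
    rwa [mul_comm]
  have hsub : {ω | δ ≤ loss f h₁ h₂ p (fun i => ξ i ω) n τ₀} ⊆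
      {ω | δ / 2 ≤ ∑ x ∈ F, t n x ω} ∪ {ω | ENNReal.ofReal (δ / 2) ≤ R ω} := by
    intro ω hω
    by_contra hcon
    simp only [mem_union, mem_ofPred_eq, not_or, not_le] at hcon hω
    have hl := ofReal_loss hf hh (fun i => ξ i ω) n hpos
    rw [← ENNReal.sum_add_tsum_compl F, ← ENNReal.ofReal_sum_of_nonneg fun x _ => ht0 n x ω] at hl
    have h1 : ENNReal.ofReal (∑ x ∈ F, t n x ω) + R ω <
        ENNReal.ofReal (δ / 2) + ENNReal.ofReal (δ / 2) :=
      ENNReal.add_lt_add ((ENNReal.ofReal_lt_ofReal_iff (half_pos hδ)).2 hcon.1) hcon.2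
    rw [← ENNReal.ofReal_add (half_pos hδ).le (half_pos hδ).le, add_halves] at h1
    exact absurd (ENNReal.ofReal_le_ofReal hω) (not_le.2 (hl.trans_lt h1))
  calc _ ≤ _ := measure_mono hsub
    _ ≤ _ := measure_union_le _ _
    _ ≤ ε / 2 + ε / 2 := add_le_add hn htailP
    _ = ε := ENNReal.add_halves ε

end Convergence

end SDRME

end

/-! ### Consistency -/

theorem theorem4p1
    -- the discrete sample space
    {X : Type*} [Countable X] [MeasurableSpace X] [DiscreteMeasurableSpace X]
    -- the Bregman generator and the two matching functions
    (f h₁ h₂ : ℝ → ℝ) (hf : SDRME.IsGenerator f) (hh : SDRME.IsMatchingPair h₁ h₂)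
    -- the unnormalized model, the parameter space of `τ = (c, θ)` and the true parameter
    {d : ℕ} (p : X → EuclideanSpace ℝ (Fin d) → ℝ)
    (T : Set (SDRME.Param d)) (τstar : SDRME.Param d)
    (hp_pos : ∀ τ ∈ T, ∀ x, 0 < p x τ.2)
    (hp_sum : ∀ τ ∈ T, Summable (fun x => p x τ.2))
    (hC2 : ∀ x, ContDiffOn ℝ 2 (fun τ => SDRME.extModel p τ x) T)
    (hT : IsCompact T) (hτstar : τstar ∈ interior T)
    -- the true density: well-specified and identified
    (η : X → ℝ)
    (hη : ∀ x, η x = SDRME.extModel p τstar x)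
    (hc : HasSum (fun x => p x τstar.2) (Real.exp τstar.1))
    (hident : ∀ τ ∈ T, ((∀ x, SDRME.extModel p τ x = η x) ↔ τ = τstar))
    -- on an infinite sample space the loss is integrable in the tail of the true density
    (htail : Infinite X → SDRME.TailIntegrable f h₁ h₂ η)
    -- i.i.d. observations with density `η` with respect to the counting measure
    {Ω : Type*} [MeasurableSpace Ω] (P : Measure Ω) [IsProbabilityMeasure P]
    (ξ : ℕ → Ω → X) (hξ_meas : ∀ i, Measurable (ξ i))
    (hξ_indep : iIndepFun ξ P)
    (hξ_law : ∀ i, P.map (ξ i) = Measure.count.withDensity (fun x => ENNReal.ofReal (η x)))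
    -- the estimator
    (τhat : ℕ → Ω → SDRME.Param d)
    (hτhat : ∀ n, 1 ≤ n → ∀ᵐ ω ∂P,
      SDRME.IsSDRME f h₁ h₂ p T (fun i => ξ i ω) n (τhat n ω)) :
    TendstoInMeasure P τhat atTop (fun _ => τstar) := by
  have hτT : τstar ∈ T := interior_subset hτstar
  have hpos : ∀ τ ∈ T, ∀ x, 0 < SDRME.extModel p τ x := fun τ hτ x =>
    mul_pos (Real.exp_pos _) (hp_pos τ hτ x)
  obtain rfl : η = SDRME.extModel p τstar := funext hη
  have hsum : HasSum (SDRME.extModel p τstar) 1 := by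
    have h := hc.mul_left (Real.exp (-τstar.1))
    rwa [← Real.exp_add, neg_add_cancel, Real.exp_zero] at h
  have hlaw : ∀ i x, P (ξ i ⁻¹' {x}) = ENNReal.ofReal (SDRME.extModel p τstar x) := by
    intro i x
    rw [← Measure.map_apply (hξ_meas i) (.of_discrete), hξ_law i,
      withDensity_apply _ .of_discrete, Measure.restrict_singleton, Measure.count_singleton]
    simp
  have hlim : ∀ x, ∀ᵐ ω ∂P, Tendsto (fun n => SDRME.empDensity (fun i => ξ i ω) n x) atTop
      (𝓝 (SDRME.extModel p τstar x)) := fun x =>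
    SDRME.ae_tendsto_empDensity hξ_meas hξ_indep x (hpos τstar hτT x).le
      (fun i => (hξ_law i).trans (hξ_law 0).symm) (hlaw 0 x)
  rw [tendstoInMeasure_iff_dist]
  intro ε hε
  obtain ⟨F, r, δ, hr, hδ, hF⟩ := SDRME.exists_separating_loss hf hh hT hpos
    (fun x => (hC2 x).continuousOn) (hpos τstar hτT) (fun τ hτ => (hident τ hτ).1) hε
  have hbound : Tendsto (fun n =>
      (∑ x ∈ F, P {ω | r x ≤ dist (SDRME.empDensity (fun i => ξ i ω) n x)
        (SDRME.extModel p τstar x)}) +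
      ∑ x ∈ F, P {ω | δ x ≤ SDRME.loss f h₁ h₂ p (fun i => ξ i ω) n τstar}) atTop (𝓝 0) := by
    have h1 : ∀ x, Tendsto (fun n => P {ω | r x ≤
        dist (SDRME.empDensity (fun i => ξ i ω) n x) (SDRME.extModel p τstar x)}) atTop (𝓝 0) :=
      fun x => tendstoInMeasure_iff_dist.1 (tendstoInMeasure_of_tendsto_ae
        (g := fun _ => SDRME.extModel p τstar x) (fun n =>
        (SDRME.measurable_comp_empDensity hξ_meas n x id).aestronglyMeasurable) (hlim x))
        (r x) (hr x)
    have h2 : ∀ x, Tendsto (fun n =>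
        P {ω | δ x ≤ SDRME.loss f h₁ h₂ p (fun i => ξ i ω) n τstar}) atTop (𝓝 0) :=
      fun x => SDRME.tendsto_measure_le_loss hf hh hξ_meas hξ_indep (hpos τstar hτT) hsum hlaw
        hlim htail (hδ x)
    simpa using (tendsto_finsetSum F fun x _ => h1 x).add (tendsto_finsetSum F fun x _ => h2 x)
  refine tendsto_of_tendsto_of_tendsto_of_le_of_le' tendsto_const_nhds hbound
    (.of_forall fun _ => zero_le) ?_
  filter_upwards [eventually_ge_atTop 1] with n hn
  -- An estimate far from `τstar` forces either an inaccurate empirical density at some point of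
  -- `F`, or a large loss at the minimizer and hence at `τstar`.
  have hsub : {ω | ε ≤ dist (τhat n ω) τstar} ≤ᵐ[P]
      ((⋃ x ∈ F, {ω | r x ≤ dist (SDRME.empDensity (fun i => ξ i ω) n x)
        (SDRME.extModel p τstar x)}) ∪
      ⋃ x ∈ F, {ω | δ x ≤ SDRME.loss f h₁ h₂ p (fun i => ξ i ω) n τstar} : Set Ω) := by
    filter_upwards [hτhat n hn] with ω hω hd
    by_cases hclose : ∀ x ∈ F,
        |SDRME.empDensity (fun i => ξ i ω) n x - SDRME.extModel p τstar x| < r x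
    · obtain ⟨x, hx, hle⟩ := hF _ n hclose _ hω.1 hd
      exact Or.inr (mem_biUnion (show x ∈ (F : Set X) from hx) (hle.trans (hω.2 hτT)))
    · push Not at hclose
      obtain ⟨x, hx, hle⟩ := hclose
      exact Or.inl (mem_biUnion (show x ∈ (F : Set X) from hx) hle)
  exact (measure_mono_ae hsub).trans ((measure_union_le _ _).trans
    (add_le_add (measure_biUnion_finset_le _ _) (measure_biUnion_finset_le _ _)))
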